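/- A probability on $\mathbb Z^+=\{0,1,2,\dots\}$ is a function $F\colon\mathbb Z^+\to[0,1]$ with $\sum_{k\ge 0}F(k)=1$. Let $F^{(n)}$ be its $n$-th convolution power ($F^{(0)}=\delta_0$), let $\|F\|_1=\sum_k|F(k)|$, and let $\widehat F(\xi)=\sum_{k\ge0}F(k)e^{-ik\xi}$ for $\xi\in[-\pi,\pi]$. Let $\mathcal A$ be the set of all probabilities $F$ on $\mathbb Z^+$ with $\sup_{n\ge1}n\|F^{(n)}-F^{(n+1)}\|_1<\infty$. A probability $F$ on $\mathbb Z^+$ is aperiodic if for every $m\in\mathbb Z$ the set $\{m+k: F(k)\ne0\}$ generates the additive group $\mathbb Z$. For $\alpha\in(0,1)$ put $A_\alpha(0)=0$ and $$A_\alpha(k)=\frac{\alpha(1-\alpha)(2-\alpha)\cdots((k-1)-\alpha)}{k!}\qquad(k\ge1).$$ For $\alpha\in(0,1)$, consider the following two conditions. (I) (on a probability $F$ on $\mathbb Z^+$) $F$ is aperiodic, there is $\delta\in(0,1)$ such that $1-\operatorname{Re}\widehat F(\xi)\ge\delta|\xi|^\alpha$ for all $\xi\in[-\delta,\delta]$,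 and there is $c>0$ such that $$\widehat F\text{ is differentiable at }\xi\text{ and }|\partial_\xi\widehat F(\xi)|\le c|\xi|^{\alpha-1}\quad\text{for all }\xi\in[-\pi,\pi]\setminus\{0\}.\tag{$*$}$$ (II) (on a probability $G$ on $\mathbb Z^+$) $G$ is aperiodic, and there are a probability $F$ on $\mathbb Z^+$ that satisfies (I) with the same $\alpha$ and a number $a>0$ such that $\sum_{k\ge1}k|G(k)-aF(k)|<\infty$. (At $\xi=\pm\pi$ the derivative is one-sided.) **Theorem.** Fix $\varepsilon\in(0,1]$ and let $B=\varepsilon^{-1}\int_0^\varepsilon A_\alpha\,d\alpha$, that is, $B(k)=\varepsilon^{-1}\int_0^\varepsilon A_\alpha(k)\,d\alpha$ for each $k$. Then $B$ is a probability on $\mathbb Z^+$. For $\beta\in(0,1)$ let $B_\beta=\sum_{k\ge0}A_\beta(k)B^{(k)}$. Then $B_\beta\in\mathcal A$, one has $\widehat{B_\beta}(\xi)\ne1$ for all $\xi\neq0$ close enough to $0$, and for every $\alpha\in(0,1)$ $$\lim_{\xi\to0}\frac{|\xi|^\alpha}{|1-\widehat{B_\beta}(\xi)|}=0 .$$ Consequently,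 for no $\alpha\in(0,1)$ does $B_\beta$ satisfy $(*)$ with any $c>0$; in particular, for no $\alpha\in(0,1)$ does $F=B_\beta$ satisfy (I), or $G=B_\beta$ satisfy (II). -/

import Mathlib

open Filter Topology
open scoped ENNReal

noncomputable section

namespace RittProb

/-- Probabilities on `ℤ⁺ = {0, 1, 2, …}`, as functions `ℕ → ℝ`. -/
def IsProb (F : ℕ → ℝ) : Prop :=
  (∀ k, 0 ≤ F k) ∧ HasSum F 1

/-- Convolution of functions on `ℤ⁺` (that is, of functions on `ℤ` supported in `ℤ⁺`). -/
def conv (F G : ℕ → ℝ) (m : ℕ) : ℝ :=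
  ∑ p ∈ Finset.HasAntidiagonal.antidiagonal m, F p.1 * G p.2

/-- The unit `δ₀` for convolution. -/
def delta0 : ℕ → ℝ := Pi.single 0 1

/-- The `n`-th convolution power `F⁽ⁿ⁾`, with `F⁽⁰⁾ = δ₀`. -/
def convPow (F : ℕ → ℝ) : ℕ → ℕ → ℝ
  | 0 => delta0
  | n + 1 => conv F (convPow F n)

/-- The `L¹` norm, with values in `[0, ∞]`. -/
def l1Norm (F : ℕ → ℝ) : ℝ≥0∞ := ∑' k, ENNReal.ofReal |F k|

/-- The class `𝒜` of Ritt probabilities: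
`F` is a probability on `ℤ⁺` and `sup_{n ≥ 1} n ‖F⁽ⁿ⁾ - F⁽ⁿ⁺¹⁾‖₁ < ∞`. -/
def classA : Set (ℕ → ℝ) :=
  {F | IsProb F ∧
    (⨆ n : ℕ, ⨆ _ : 1 ≤ n,
      (n : ℝ≥0∞) * l1Norm (convPow F n - convPow F (n + 1)) : ℝ≥0∞) < ∞}

/-- The Fourier transform `F̂(ξ) = ∑_k F(k) e^{-ikξ}`. -/
def fourier (F : ℕ → ℝ) (ξ : ℝ) : ℂ :=
  ∑' k : ℕ, (F k : ℂ) * Complex.exp (-(Complex.I * k * ξ))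

/-- `A_α(0) = 0` and `A_α(k) = α (1 - α) (2 - α) ⋯ ((k - 1) - α) / k!` for `k ≥ 1`. -/
def A (α : ℝ) (k : ℕ) : ℝ :=
  if k = 0 then 0 else α * (∏ j ∈ Finset.Ico 1 k, ((j : ℝ) - α)) / (k.factorial : ℝ)

/-- `B = ε⁻¹ ∫_0^ε A_α dα`. At each `k` the integrand is a polynomial in `α`. -/
def B (ε : ℝ) (k : ℕ) : ℝ := ε⁻¹ * ∫ α in (0 : ℝ)..ε, A α k

/-- `B_β = ∑_{k ≥ 0} A_β(k) B⁽ᵏ⁾`. -/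
def Bsub (ε β : ℝ) (m : ℕ) : ℝ := ∑' k : ℕ, A β k * convPow (B ε) k m

/-- `F` is aperiodic: for every `m ∈ ℤ` the support of the translate `δ_m * F`
generates the additive group `ℤ`. -/
def IsAperiodic (F : ℕ → ℝ) : Prop :=
  ∀ m : ℤ, AddSubgroup.closure {j : ℤ | ∃ k : ℕ, F k ≠ 0 ∧ j = m + k} = ⊤

/-- For some `c > 0`, `F̂` is differentiable on `[-π, π] \ {0}` with
`|∂_ξ F̂(ξ)| ≤ c |ξ|^{α - 1}` there. At `±π` the derivative is the one-sided one,
as `F̂` is regarded as a function on `[-π, π]`. -/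
def DerivBound (α : ℝ) (F : ℕ → ℝ) : Prop :=
  ∃ c : ℝ, 0 < c ∧ ∀ ξ ∈ Set.Icc (-Real.pi) Real.pi, ξ ≠ 0 →
    DifferentiableWithinAt ℝ (fourier F) (Set.Icc (-Real.pi) Real.pi) ξ ∧
    ‖derivWithin (fourier F) (Set.Icc (-Real.pi) Real.pi) ξ‖ ≤ c * |ξ| ^ (α - 1)

/-- For some `ε ∈ (0, 1)`, `1 - Re F̂(ξ) ≥ ε |ξ|^α` for all `ξ ∈ [-ε, ε]`. -/
def RealPartBound (α : ℝ) (F : ℕ → ℝ) : Prop :=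
  ∃ ε ∈ Set.Ioo (0 : ℝ) 1, ∀ ξ ∈ Set.Icc (-ε) ε, ε * |ξ| ^ α ≤ 1 - (fourier F ξ).re

/-- The Fourier-transform criterion with exponent `α` for membership of `F` in `𝒜`. -/
def FourierCriterion (α : ℝ) (F : ℕ → ℝ) : Prop :=
  IsProb F ∧ IsAperiodic F ∧ RealPartBound α F ∧ DerivBound α F

/-- The comparison criterion with exponent `α` for membership of `G` in `𝒜`: `G` is an
aperiodic probability with `∑_k k |G(k) - a F(k)| < ∞` for some `a > 0` and some `F`
that satisfies the Fourier-transform criterion with exponent `α`. -/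
def ComparisonCriterion (α : ℝ) (G : ℕ → ℝ) : Prop :=
  IsProb G ∧ IsAperiodic G ∧ ∃ F : ℕ → ℝ, FourierCriterion α F ∧
    ∃ a : ℝ, 0 < a ∧ Summable fun k : ℕ => (k : ℝ) * |G k - a * F k|

end RittProb

end

open Filter Topology
open scoped ENNReal

noncomputable section

namespace RittProb

/-! The generating function of `A α` on the closed disc is `1 - (1 - z)^α`. Averaging over `α` gives
`1 - B̂ = ε⁻¹ ∫₀^ε (1 - z)^α dα`, with `z = e^{-iξ}`. Exponents arbitrarily close to `0` contribute,
so this dominates every positive power of `|ξ|` near `0` (`le_norm_one_sub_pgf_B`). Since `1 - B̂_β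
= (1 - B̂)^β`, the same holds for `B_β` (`exists_le_norm_one_sub_fourier_Bsub`). This gives the
limit, and shows that the transform is Hölder at `0` for no positive exponent. A derivative bound
integrates to Hölder continuity (`DerivBound.holderAtZero`), and a perturbation with finite first
moment preserves it (`ComparisonCriterion.holderAtZero`). Hence all the criteria fail.

Membership in `𝒜` has two ingredients. Subordination `a ↦ ∑ a(k) b⁽ᵏ⁾` is an `L¹`-contractive
algebra homomorphism, so `B_β` inherits the property from `A β` (`subordinate_mem_classA`). For `A
β` itself (`A_mem_classA`), the difference of consecutive powers is split at `N ≈ K n^{1/β}`. Below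
`N`, Fourier inversion bounds each term by `C n^{-1-1/β}`. Above `N`, differentiating the generating
function bounds the tail by a small multiple of the preceding difference. The resulting recursion is
a contraction. -/

/-! ### The coefficients `A α` and their tails -/

/-- The tail `∏_{j=1}^N (1 - α/j)` of the series `∑ A_α(k)`. -/
def tailProd (α : ℝ) (N : ℕ) : ℝ := ∏ j ∈ Finset.range N, (1 - α / ((j : ℝ) + 1))

lemma tailProd_zero (α : ℝ) : tailProd α 0 = 1 := by simp [tailProd]

lemma tailProd_succ (α : ℝ) (N : ℕ) :
    tailProd α (N + 1) = tailProd α N * (1 - α / ((N : ℝ) + 1)) := by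
  simp [tailProd, Finset.prod_range_succ]

lemma A_zero (α : ℝ) : A α 0 = 0 := by simp [A]

lemma A_succ (α : ℝ) (k : ℕ) : A α (k + 1) = α / ((k : ℝ) + 1) * tailProd α k := by
  induction k with
  | zero => simp [A, tailProd]
  | succ k ih =>
    have h1 : A α (k + 1 + 1) = A α (k + 1) * (((k : ℝ) + 1 - α) / ((k : ℝ) + 2)) := by
      simp only [A, Nat.add_eq_zero_iff, one_ne_zero, and_false, if_false]
      rw [Finset.prod_Ico_succ_top (by omega), Nat.factorial_succ (k + 1)]
      have : ((k + 1).factorial : ℝ) ≠ 0 := by positivity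
      push_cast
      field_simp
      ring
    rw [h1, ih, tailProd_succ]
    push_cast
    field_simp
    ring

lemma A_succ_succ (α : ℝ) (k : ℕ) :
    A α (k + 2) = A α (k + 1) * (((k : ℝ) + 1 - α) / ((k : ℝ) + 2)) := by
  rw [A_succ, A_succ, tailProd_succ]
  push_cast
  field_simp
  ring

lemma one_sub_div_nonneg {α : ℝ} (h1 : α ≤ 1) (j : ℕ) : 0 ≤ 1 - α / ((j : ℝ) + 1) := by
  rw [sub_nonneg, div_le_one (by positivity)]
  have : (0 : ℝ) ≤ j := by positivity
  linarith

lemma tailProd_nonneg {α : ℝ} (h1 : α ≤ 1) (N : ℕ) : 0 ≤ tailProd α N :=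
  Finset.prod_nonneg fun j _ => one_sub_div_nonneg h1 j

lemma A_nonneg {α : ℝ} (h0 : 0 ≤ α) (h1 : α ≤ 1) (k : ℕ) : 0 ≤ A α k := by
  cases k with
  | zero => simp [A]
  | succ k =>
    rw [A_succ]
    have := tailProd_nonneg h1 k
    positivity

lemma sum_range_A (α : ℝ) (N : ℕ) :
    ∑ k ∈ Finset.range (N + 1), A α k = 1 - tailProd α N := by
  induction N with
  | zero => simp [A_zero, tailProd_zero]
  | succ N ih => rw [Finset.sum_range_succ, ih, A_succ, tailProd_succ]; ring

lemma sum_range_tailProd (α : ℝ) (N : ℕ) :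
    (1 - α) * ∑ j ∈ Finset.range N, tailProd α j = N * tailProd α N := by
  induction N with
  | zero => simp
  | succ N ih =>
    rw [Finset.sum_range_succ, mul_add, ih, tailProd_succ]
    push_cast
    field_simp
    ring

/-- Each factor satisfies `1 - x ≤ e^{-x}`, and the harmonic sum is at least `log (N + 1)`. -/
lemma tailProd_le_rpow {α : ℝ} (h0 : 0 ≤ α) (h1 : α ≤ 1) (N : ℕ) :
    tailProd α N ≤ ((N : ℝ) + 1) ^ (-α) := by
  have hN : (0 : ℝ) < (N : ℝ) + 1 := by positivity
  have hlog : Real.log ((N : ℝ) + 1) ≤ ∑ j ∈ Finset.range N, ((j : ℝ) + 1)⁻¹ := by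
    have := log_add_one_le_harmonic N
    simpa [harmonic] using this
  calc tailProd α N ≤ ∏ j ∈ Finset.range N, Real.exp (-(α * ((j : ℝ) + 1)⁻¹)) := by
        refine Finset.prod_le_prod (fun j _ => one_sub_div_nonneg h1 j) fun j _ => ?_
        have := Real.add_one_le_exp (-(α * ((j : ℝ) + 1)⁻¹))
        rw [div_eq_mul_inv]
        linarith
    _ = Real.exp (-(α * ∑ j ∈ Finset.range N, ((j : ℝ) + 1)⁻¹)) := by
        rw [← Real.exp_sum, Finset.mul_sum, Finset.sum_neg_distrib]
    _ ≤ ((N : ℝ) + 1) ^ (-α) := by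
        rw [Real.rpow_def_of_pos hN, Real.exp_le_exp]
        nlinarith

lemma tendsto_tailProd {α : ℝ} (h0 : 0 < α) (h1 : α ≤ 1) :
    Tendsto (tailProd α) atTop (𝓝 0) := by
  refine squeeze_zero (tailProd_nonneg h1) (tailProd_le_rpow h0.le h1) ?_
  exact (tendsto_rpow_neg_atTop h0).comp
    (tendsto_atTop_add_const_right _ _ tendsto_natCast_atTop_atTop)

lemma hasSum_A {α : ℝ} (h0 : 0 < α) (h1 : α ≤ 1) : HasSum (A α) 1 := by
  rw [hasSum_iff_tendsto_nat_of_nonneg (A_nonneg h0.le h1), ← tendsto_add_atTop_iff_nat 1]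
  simp_rw [sum_range_A]
  simpa using (tendsto_tailProd h0 h1).const_sub 1

lemma isProb_A {α : ℝ} (h0 : 0 < α) (h1 : α ≤ 1) : IsProb (A α) :=
  ⟨A_nonneg h0.le h1, hasSum_A h0 h1⟩

lemma continuous_A (k : ℕ) : Continuous fun α => A α k := by
  unfold A
  split_ifs
  · fun_prop
  · fun_prop

/-! ### Generating functions and the binomial series -/

/-- The generating function `∑_k F(k) z^k`. -/
def pgf (F : ℕ → ℝ) (z : ℂ) : ℂ := ∑' k : ℕ, (F k : ℂ) * z ^ k

lemma fourier_eq_pgf (F : ℕ → ℝ) (ξ : ℝ) :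
    fourier F ξ = pgf F (Complex.exp (-(Complex.I * ξ))) := by
  unfold fourier pgf
  congr 1
  ext k
  rw [← Complex.exp_nat_mul]
  congr 2
  ring

lemma norm_mul_pow_le (F : ℕ → ℝ) {z : ℂ} (hz : ‖z‖ ≤ 1) (k : ℕ) :
    ‖(F k : ℂ) * z ^ k‖ ≤ |F k| := by
  rw [norm_mul, norm_pow, Complex.norm_real, Real.norm_eq_abs]
  exact mul_le_of_le_one_right (abs_nonneg _) (pow_le_one₀ (norm_nonneg _) hz)

lemma summable_norm_pgf {F : ℕ → ℝ} (hF : Summable fun k => |F k|) {z : ℂ} (hz : ‖z‖ ≤ 1) :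
    Summable fun k => ‖(F k : ℂ) * z ^ k‖ :=
  hF.of_nonneg_of_le (fun _ => norm_nonneg _) (norm_mul_pow_le F hz)

lemma hasSum_pgf {F : ℕ → ℝ} (hF : Summable fun k => |F k|) {z : ℂ} (hz : ‖z‖ ≤ 1) :
    HasSum (fun k => (F k : ℂ) * z ^ k) (pgf F z) :=
  (summable_norm_pgf hF hz).of_norm.hasSum

lemma continuousOn_pgf {F : ℕ → ℝ} (hF : Summable fun k => |F k|) :
    ContinuousOn (pgf F) (Metric.closedBall 0 1) := by
  refine continuousOn_tsum (fun k => by fun_prop) hF fun k z hz => ?_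
  exact norm_mul_pow_le F (by simpa using hz) k

lemma IsProb.summable_abs {F : ℕ → ℝ} (hF : IsProb F) : Summable fun k => |F k| :=
  hF.2.summable.abs

lemma IsProb.tsum_abs {F : ℕ → ℝ} (hF : IsProb F) : ∑' k, |F k| = 1 := by
  simp_rw [abs_of_nonneg (hF.1 _)]
  exact hF.2.tsum_eq

lemma norm_pgf_le {F : ℕ → ℝ} (hF : Summable fun k => |F k|) {z : ℂ} (hz : ‖z‖ ≤ 1) :
    ‖pgf F z‖ ≤ ∑' k, |F k| :=
  tsum_of_norm_bounded hF.hasSum (norm_mul_pow_le F hz)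

lemma IsProb.norm_pgf_le_one {F : ℕ → ℝ} (hF : IsProb F) {z : ℂ} (hz : ‖z‖ ≤ 1) :
    ‖pgf F z‖ ≤ 1 :=
  (norm_pgf_le hF.summable_abs hz).trans_eq hF.tsum_abs

lemma choose_mul_neg_one_pow (α : ℝ) (k : ℕ) :
    Ring.choose (α : ℂ) (k + 1) * (-1) ^ (k + 1) = -(A α (k + 1) : ℂ) := by
  have key : ∀ n : ℕ, Ring.choose (α : ℂ) (n + 1) =
      Ring.choose (α : ℂ) n * (((α : ℂ) - n) / ((n : ℂ) + 1)) := by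
    intro n
    have h1 : (n.factorial : ℂ) ≠ 0 := by exact_mod_cast n.factorial_ne_zero
    have h2 : ((n : ℂ) + 1) ≠ 0 := by exact_mod_cast n.succ_ne_zero
    rw [Ring.choose_eq_smul, Ring.choose_eq_smul, descPochhammer_succ_right,
      Polynomial.smeval_mul, Nat.factorial_succ]
    simp only [Polynomial.smeval_sub, Polynomial.smeval_X, Polynomial.smeval_natCast, smul_eq_mul]
    push_cast
    field_simp
    simp
  induction k with
  | zero => simp [A]
  | succ k ih =>
    rw [key, A_succ_succ, pow_succ]
    push_cast
    have h2 : ((k : ℂ) + 2) ≠ 0 := by exact_mod_cast (k + 1).succ_ne_zero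
    have e : Ring.choose (α : ℂ) (k + 1) * (((α : ℂ) - ((k : ℂ) + 1)) / ((k : ℂ) + 1 + 1)) *
        ((-1) ^ (k + 1) * -1) = (Ring.choose (α : ℂ) (k + 1) * (-1) ^ (k + 1)) *
        -(((α : ℂ) - ((k : ℂ) + 1)) / ((k : ℂ) + 1 + 1)) := by ring
    rw [e, ih, show (k : ℂ) + 1 + 1 = k + 2 by ring]
    ring

lemma pgf_A_of_norm_lt_one (α : ℝ) {z : ℂ} (hz : ‖z‖ < 1) :
    pgf (A α) z = 1 - (1 - z) ^ (α : ℂ) := by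
  have h := (Complex.one_add_cpow_hasFPowerSeriesOnBall_zero (a := (α : ℂ))).hasSum
    (y := -z) (by simpa [Metric.mem_eball, edist_zero_right, enorm_eq_nnnorm] using (show ‖z‖₊ < 1 from hz))
  have h' : HasSum (fun n : ℕ => Ring.choose (α : ℂ) n * (-z) ^ n) ((1 - z) ^ (α : ℂ)) := by
    simpa [sub_eq_add_neg, List.ofFn_const, binomialSeries_apply, -FormalMultilinearSeries.apply_eq_prod_smul_coeff] using h
  have h2 : HasSum (fun n : ℕ => (if n = 0 then (1 : ℂ) else 0) -
      Ring.choose (α : ℂ) n * (-z) ^ n) (1 - (1 - z) ^ (α : ℂ)) :=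
    (hasSum_ite_eq 0 (1 : ℂ)).sub h'
  rw [pgf, ← h2.tsum_eq]
  congr 1
  ext k
  cases k with
  | zero => simp [A]
  | succ k =>
    rw [neg_eq_neg_one_mul z, mul_pow, ← mul_assoc, choose_mul_neg_one_pow]
    simp

lemma one_sub_re_pos {z : ℂ} (hz : ‖z‖ ≤ 1) (hz1 : z ≠ 1) : 0 < (1 - z).re := by
  have h2 := Complex.sq_norm_sub_sq_re z
  have h3 := Complex.re_le_norm z
  have : z.re < 1 := by
    refine lt_of_le_of_ne (h3.trans hz) fun h => hz1 ?_
    have : z.im = 0 := by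
      rw [h] at h2
      have : ‖z‖ ^ 2 ≤ 1 := pow_le_one₀ (norm_nonneg _) hz
      nlinarith [sq_nonneg z.im]
    exact Complex.ext h this
  simpa using this

/-- The binomial series covers the open disc. Both sides extend continuously to the circle away from
`z = 1`, where `1 - z` has positive real part. At `z = 1` the base leaves the slit plane, and the
total mass `1` is used instead. -/
lemma pgf_A {α : ℝ} (h0 : 0 < α) (h1 : α ≤ 1) {z : ℂ} (hz : ‖z‖ ≤ 1) :
    pgf (A α) z = 1 - (1 - z) ^ (α : ℂ) := by
  rcases hz.lt_or_eq with hz' | hz'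
  · exact pgf_A_of_norm_lt_one α hz'
  by_cases hz1 : z = 1
  · subst hz1
    have h : ((α : ℂ)) ≠ 0 := by exact_mod_cast h0.ne'
    rw [sub_self, Complex.zero_cpow h, sub_zero, pgf]
    simp only [one_pow, mul_one]
    rw [← Complex.ofReal_tsum, (hasSum_A h0 h1).tsum_eq, Complex.ofReal_one]
  have hre : 0 < (1 - z).re := one_sub_re_pos hz hz1
  have hcl : z ∈ closure (Metric.ball (0 : ℂ) 1) := by
    rw [closure_ball _ one_ne_zero]; simpa using hz
  have : (𝓝[Metric.ball (0 : ℂ) 1] z).NeBot := mem_closure_iff_nhdsWithin_neBot.1 hcl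
  have hA : Tendsto (pgf (A α)) (𝓝[Metric.ball (0 : ℂ) 1] z) (𝓝 (pgf (A α) z)) :=
    ((continuousOn_pgf (isProb_A h0 h1).summable_abs) z (by simpa using hz)).mono
      Metric.ball_subset_closedBall
  have hB : Tendsto (fun z : ℂ => 1 - (1 - z) ^ (α : ℂ)) (𝓝[Metric.ball (0 : ℂ) 1] z)
      (𝓝 (1 - (1 - z) ^ (α : ℂ))) := by
    refine tendsto_nhdsWithin_of_tendsto_nhds (ContinuousAt.tendsto ?_)
    exact continuousAt_const.sub ((continuousAt_const.sub continuousAt_id).cpow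
      continuousAt_const (Or.inl hre))
  refine tendsto_nhds_unique hA (hB.congr' ?_)
  filter_upwards [self_mem_nhdsWithin] with w hw
  exact (pgf_A_of_norm_lt_one α (by simpa using hw)).symm

/-! ### Estimates for `1 - z` and its powers on the closed disc -/

lemma norm_one_sub_le_two_mul_cos {z : ℂ} (hz : ‖z‖ ≤ 1) (hz1 : z ≠ 1) :
    ‖1 - z‖ ≤ 2 * Real.cos (1 - z).arg := by
  have hpos : 0 < ‖1 - z‖ := norm_pos_iff.2 (sub_ne_zero.2 hz1.symm)
  have h1 : ‖1 - z‖ ^ 2 = 1 - 2 * z.re + ‖z‖ ^ 2 := by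
    rw [Complex.sq_norm, Complex.sq_norm, Complex.normSq_apply, Complex.normSq_apply]
    simp
    ring
  have h2 : ‖z‖ ^ 2 ≤ 1 := pow_le_one₀ (norm_nonneg _) hz
  have h3 : ‖1 - z‖ * Real.cos (1 - z).arg = 1 - z.re := by
    rw [Complex.norm_mul_cos_arg]; simp
  nlinarith

/-- Both sides are compared with `β cos φ + (1 - β)`: weighted AM-GM on the left, concavity of
cosine on the right. -/
lemma rpow_cos_le_cos_mul {β φ : ℝ} (h0 : 0 ≤ β) (h1 : β ≤ 1) (hφ : |φ| ≤ Real.pi / 2) :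
    Real.cos φ ^ β ≤ Real.cos (φ * β) := by
  have hφ' := abs_le.1 hφ
  have hc : 0 ≤ Real.cos φ := Real.cos_nonneg_of_mem_Icc hφ'
  have h2 := Real.geom_mean_le_arith_mean2_weighted h0 (sub_nonneg.2 h1) hc zero_le_one (by ring)
  rw [Real.one_rpow, mul_one] at h2
  refine h2.trans ?_
  have h3 := strictConcaveOn_cos_Icc.concaveOn.2 (x := φ) (y := 0) hφ'
    (by constructor <;> linarith [Real.pi_pos]) h0 (sub_nonneg.2 h1) (by ring)
  simpa [mul_comm] using h3

lemma cos_mul_pi_div_two_le {β φ : ℝ} (h0 : 0 ≤ β) (h1 : β ≤ 1) (hφ : |φ| ≤ Real.pi / 2) :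
    Real.cos (β * (Real.pi / 2)) ≤ Real.cos (φ * β) := by
  rw [← Real.cos_abs (φ * β)]
  refine Real.cos_le_cos_of_nonneg_of_le_pi (abs_nonneg _) ?_ ?_
  · nlinarith [Real.pi_pos]
  · rw [abs_mul, abs_of_nonneg h0, mul_comm]
    gcongr

lemma abs_arg_one_sub_le {z : ℂ} (hz : ‖z‖ ≤ 1) (hz1 : z ≠ 1) :
    |(1 - z).arg| ≤ Real.pi / 2 :=
  Complex.abs_arg_le_pi_div_two_iff.2 (one_sub_re_pos hz hz1).le

lemma norm_one_sub_cpow {α : ℝ} {z : ℂ} (hz1 : z ≠ 1) :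
    ‖(1 - z) ^ (α : ℂ)‖ = ‖1 - z‖ ^ α := by
  rw [Complex.norm_cpow_of_ne_zero (sub_ne_zero.2 hz1.symm)]
  simp

/-- With `w = (1 - z)^β`, `|1 - w|² = 1 - 2 Re w + |w|²`. In polar coordinates about `1` the disc
gives `|w| ≤ 2^β cos (β arg (1 - z))`, so `|w|²` is at most `2^β Re w`. As `2^β < 2`, a fixed
multiple of `|w|` is gained. -/
lemma exists_norm_one_sub_cpow_le {β : ℝ} (h0 : 0 < β) (h1 : β < 1) :
    ∃ c : ℝ, 0 < c ∧ ∀ z : ℂ, ‖z‖ ≤ 1 →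
      ‖1 - (1 - z) ^ (β : ℂ)‖ ≤ Real.exp (-(c * ‖1 - z‖ ^ β)) := by
  have hpi := Real.pi_pos
  have hcos : 0 < Real.cos (β * (Real.pi / 2)) :=
    Real.cos_pos_of_mem_Ioo ⟨by nlinarith, by nlinarith⟩
  have h2 : (2 : ℝ) ^ β < 2 := by
    simpa using Real.rpow_lt_rpow_of_exponent_lt one_lt_two h1
  set c := (2 - 2 ^ β) * Real.cos (β * (Real.pi / 2)) with hc
  have hcpos : 0 < c := mul_pos (by linarith) hcos
  refine ⟨c / 2, by positivity, fun z hz => ?_⟩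
  by_cases hz1 : z = 1
  · subst hz1
    have h : ((β : ℂ)) ≠ 0 := by exact_mod_cast h0.ne'
    simp [Complex.zero_cpow h, Real.zero_rpow h0.ne']
  set w := (1 - z) ^ (β : ℂ) with hw
  set ρ := ‖1 - z‖ ^ β with hρ
  have hρ0 : 0 ≤ ρ := by positivity
  have hwn : ‖w‖ = ρ := norm_one_sub_cpow hz1
  have hwre : w.re = ρ * Real.cos ((1 - z).arg * β) := Complex.cpow_ofReal_re _ _
  have harg := abs_arg_one_sub_le hz hz1
  have hcosarg : 0 ≤ Real.cos (1 - z).arg := Real.cos_nonneg_of_mem_Icc (abs_le.1 harg)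
  have hρle : ρ ≤ 2 ^ β * Real.cos ((1 - z).arg * β) := by
    calc ρ ≤ (2 * Real.cos (1 - z).arg) ^ β :=
          Real.rpow_le_rpow (norm_nonneg _) (norm_one_sub_le_two_mul_cos hz hz1) h0.le
      _ = 2 ^ β * Real.cos (1 - z).arg ^ β := Real.mul_rpow (by norm_num) hcosarg
      _ ≤ _ := by
        gcongr
        exact rpow_cos_le_cos_mul h0.le h1.le harg
  have hccos : c ≤ (2 - 2 ^ β) * Real.cos ((1 - z).arg * β) :=
    mul_le_mul_of_nonneg_left (cos_mul_pi_div_two_le h0.le h1.le harg) (by linarith)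
  have hsq : ‖1 - w‖ ^ 2 = 1 - 2 * w.re + ‖w‖ ^ 2 := by
    rw [Complex.sq_norm, Complex.sq_norm, Complex.normSq_apply, Complex.normSq_apply]
    simp
    ring
  have hle : ‖1 - w‖ ^ 2 ≤ 1 - c * ρ := by
    rw [hsq, hwn, hwre]
    nlinarith
  refine le_of_sq_le_sq ?_ (Real.exp_pos _).le
  calc ‖1 - w‖ ^ 2 ≤ 1 - c * ρ := hle
    _ ≤ Real.exp (-(c * ρ)) := by linarith [Real.add_one_le_exp (-(c * ρ))]
    _ = Real.exp (-(c / 2 * ρ)) ^ 2 := by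
      rw [← Real.exp_nat_mul]
      congr 1
      push_cast
      ring

lemma norm_one_sub_exp (ξ : ℝ) :
    ‖1 - Complex.exp (-(Complex.I * ξ))‖ = 2 * |Real.sin (ξ / 2)| := by
  have h := Complex.norm_exp_I_mul_ofReal_sub_one (-ξ)
  rw [norm_sub_rev]
  simpa [neg_div] using h

lemma norm_exp_neg_I_mul (ξ : ℝ) : ‖Complex.exp (-(Complex.I * ξ))‖ = 1 := by
  simpa using Complex.norm_exp_I_mul_ofReal (-ξ)

lemma norm_one_sub_exp_le (ξ : ℝ) : ‖1 - Complex.exp (-(Complex.I * ξ))‖ ≤ |ξ| := by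
  rw [norm_one_sub_exp]
  have := Real.abs_sin_le_abs (x := ξ / 2)
  rw [abs_div, abs_two] at this
  linarith

lemma le_norm_one_sub_exp {ξ : ℝ} (hξ : |ξ| ≤ Real.pi) :
    2 / Real.pi * |ξ| ≤ ‖1 - Complex.exp (-(Complex.I * ξ))‖ := by
  rw [norm_one_sub_exp]
  have := Real.mul_abs_le_abs_sin (x := ξ / 2) (by rw [abs_div, abs_two]; linarith)
  rw [abs_div, abs_two] at this
  linarith

/-! ### Convolution as multiplication of power series -/

lemma conv_eq_coeff (F G : ℕ → ℝ) (m : ℕ) :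
    conv F G m = PowerSeries.coeff m (PowerSeries.mk F * PowerSeries.mk G) := by
  simp [conv, PowerSeries.coeff_mul]

lemma convPow_eq_coeff (F : ℕ → ℝ) (n m : ℕ) :
    convPow F n m = PowerSeries.coeff m (PowerSeries.mk F ^ n) := by
  induction n generalizing m with
  | zero => simp [convPow, delta0, Pi.single_apply, PowerSeries.coeff_one]
  | succ n ih =>
    have : PowerSeries.mk (convPow F n) = PowerSeries.mk F ^ n := by ext k; simp [ih]
    rw [convPow, conv_eq_coeff, this, pow_succ']

lemma summable_abs_conv {F G : ℕ → ℝ} (hF : Summable fun k => |F k|)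
    (hG : Summable fun k => |G k|) : Summable fun k => |conv F G k| :=
  summable_norm_sum_mul_antidiagonal_of_summable_norm (f := F) (g := G) hF hG

lemma pgf_conv {F G : ℕ → ℝ} (hF : Summable fun k => |F k|) (hG : Summable fun k => |G k|)
    {z : ℂ} (hz : ‖z‖ ≤ 1) : pgf (conv F G) z = pgf F z * pgf G z := by
  rw [pgf, pgf, pgf, tsum_mul_tsum_eq_tsum_sum_antidiagonal_of_summable_norm
    (summable_norm_pgf hF hz) (summable_norm_pgf hG hz)]
  congr 1
  ext m
  rw [conv, Complex.ofReal_sum, Finset.sum_mul]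
  refine Finset.sum_congr rfl fun p hp => ?_
  rw [← Finset.HasAntidiagonal.mem_antidiagonal.1 hp, pow_add]
  push_cast
  ring

lemma isProb_delta0 : IsProb delta0 := by
  refine ⟨fun k => ?_, hasSum_pi_single 0 1⟩
  by_cases h : k = 0 <;> simp [delta0, h]

lemma IsProb.conv {F G : ℕ → ℝ} (hF : IsProb F) (hG : IsProb G) : IsProb (conv F G) := by
  refine ⟨fun k => Finset.sum_nonneg fun p _ => mul_nonneg (hF.1 _) (hG.1 _), ?_⟩
  have h := tsum_mul_tsum_eq_tsum_sum_antidiagonal_of_summable_norm (f := F) (g := G)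
    hF.summable_abs hG.summable_abs
  rw [hF.2.tsum_eq, hG.2.tsum_eq, one_mul] at h
  rw [h]
  exact (summable_abs_conv hF.summable_abs hG.summable_abs).of_abs.hasSum

lemma IsProb.convPow {F : ℕ → ℝ} (hF : IsProb F) (n : ℕ) : IsProb (convPow F n) := by
  induction n with
  | zero => exact isProb_delta0
  | succ n ih => exact hF.conv ih

lemma pgf_convPow {F : ℕ → ℝ} (hF : IsProb F) (n : ℕ) {z : ℂ} (hz : ‖z‖ ≤ 1) :
    pgf (convPow F n) z = pgf F z ^ n := by
  induction n with
  | zero =>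
    rw [pgf, pow_zero, tsum_eq_single 0]
    · simp [convPow, delta0]
    · intro k hk
      simp [convPow, delta0, hk]
  | succ n ih =>
    rw [RittProb.convPow, pgf_conv hF.summable_abs (hF.convPow n).summable_abs hz, ih, pow_succ']

lemma l1Norm_eq_tsum_enorm (F : ℕ → ℝ) : l1Norm F = ∑' k, ‖F k‖ₑ := by
  simp only [l1Norm, Real.enorm_eq_ofReal_abs]

lemma l1Norm_eq_ofReal {F : ℕ → ℝ} (hF : Summable fun k => |F k|) :
    l1Norm F = ENNReal.ofReal (∑' k, |F k|) :=
  (ENNReal.ofReal_tsum_of_nonneg (fun _ => abs_nonneg _) hF).symm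

lemma IsProb.l1Norm_eq_one {F : ℕ → ℝ} (hF : IsProb F) : l1Norm F = 1 := by
  rw [l1Norm_eq_ofReal hF.summable_abs, hF.tsum_abs, ENNReal.ofReal_one]

lemma pgf_one {F : ℕ → ℝ} (hF : IsProb F) : pgf F 1 = 1 := by
  simp only [pgf, one_pow, mul_one]
  rw [← Complex.ofReal_tsum, hF.2.tsum_eq, Complex.ofReal_one]

/-! ### Subordination -/

/-- The subordinate `∑_k a(k) b⁽ᵏ⁾`. -/
def subordinate (a b : ℕ → ℝ) (m : ℕ) : ℝ := ∑' k : ℕ, a k * convPow b k m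

lemma Bsub_eq_subordinate (ε β : ℝ) : Bsub ε β = subordinate (A β) (B ε) := rfl

lemma coeff_subst_mk {b : ℕ → ℝ} (hb : b 0 = 0) (a : PowerSeries ℝ) (m : ℕ) :
    PowerSeries.coeff m (a.subst (PowerSeries.mk b)) =
      subordinate (fun k => PowerSeries.coeff k a) b m := by
  have hs : PowerSeries.HasSubst (PowerSeries.mk b) :=
    PowerSeries.HasSubst.of_constantCoeff_zero' (by simp [hb])
  rw [PowerSeries.coeff_subst' hs, subordinate,
    tsum_eq_finsum (L := .unconditional ℕ)]
  · simp [convPow_eq_coeff]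
  · simpa [convPow_eq_coeff] using PowerSeries.coeff_subst_finite' hs a m

/-- As `b 0 = 0`, subordination is formal substitution of power series, which is a ring
homomorphism; no summability of `a` is needed. -/
lemma convPow_subordinate_sub {b : ℕ → ℝ} (hb : b 0 = 0) (a : ℕ → ℝ) (n n' : ℕ) :
    convPow (subordinate a b) n - convPow (subordinate a b) n' =
      subordinate (convPow a n - convPow a n') b := by
  have hs : PowerSeries.HasSubst (PowerSeries.mk b) :=
    PowerSeries.HasSubst.of_constantCoeff_zero' (by simp [hb])
  have h1 : PowerSeries.mk (subordinate a b) = (PowerSeries.mk a).subst (PowerSeries.mk b) := by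
    ext m
    rw [coeff_subst_mk hb]
    simp
  ext m
  have h2 : (convPow a n - convPow a n' : ℕ → ℝ) =
      fun k => PowerSeries.coeff k (PowerSeries.mk a ^ n - PowerSeries.mk a ^ n') := by
    ext k
    simp [convPow_eq_coeff]
  rw [h2, ← coeff_subst_mk hb, PowerSeries.subst_sub hs, PowerSeries.subst_pow hs,
    PowerSeries.subst_pow hs, ← h1]
  simp [convPow_eq_coeff]

/-- Triangle inequality, Tonelli in `[0, ∞]`, and the fact that every `b⁽ᵏ⁾` has norm `1`. -/
lemma l1Norm_subordinate_le (a : ℕ → ℝ) {b : ℕ → ℝ} (hb : IsProb b) :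
    l1Norm (subordinate a b) ≤ l1Norm a := by
  rw [l1Norm_eq_tsum_enorm]
  calc ∑' m, ‖subordinate a b m‖ₑ ≤ ∑' m, ∑' k, ‖a k * convPow b k m‖ₑ :=
        ENNReal.tsum_le_tsum fun m => enorm_tsum_le_tsum_enorm
    _ = ∑' k, ∑' m, ‖a k‖ₑ * ‖convPow b k m‖ₑ := by
        rw [ENNReal.tsum_comm]
        simp_rw [enorm_mul]
    _ = ∑' k, ‖a k‖ₑ * l1Norm (convPow b k) := by
        simp_rw [ENNReal.tsum_mul_left, l1Norm_eq_tsum_enorm]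
    _ = l1Norm a := by
        simp_rw [(hb.convPow _).l1Norm_eq_one, mul_one, l1Norm_eq_tsum_enorm]

lemma summable_subordinate_prod {a b : ℕ → ℝ} (ha : IsProb a) (hb : IsProb b) :
    Summable (Function.uncurry fun k m : ℕ => a k * convPow b k m) := by
  have h0 : 0 ≤ Function.uncurry fun k m : ℕ => a k * convPow b k m :=
    fun p => mul_nonneg (ha.1 p.1) ((hb.convPow p.1).1 p.2)
  have h1 : ∀ k, HasSum (fun m => a k * convPow b k m) (a k) := fun k => by
    simpa using (hb.convPow k).2.mul_left (a k)
  rw [summable_prod_of_nonneg h0]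
  refine ⟨fun k => (h1 k).summable, ?_⟩
  simp only [Function.uncurry_apply_pair, (h1 _).tsum_eq]
  exact ha.2.summable

lemma IsProb.subordinate {a b : ℕ → ℝ} (ha : IsProb a) (hb : IsProb b) :
    IsProb (subordinate a b) := by
  refine ⟨fun m => tsum_nonneg fun k => mul_nonneg (ha.1 _) ((hb.convPow _).1 _), ?_⟩
  have hs := summable_subordinate_prod ha hb
  have h : ∑' m, RittProb.subordinate a b m = 1 := by
    simp only [RittProb.subordinate]
    rw [hs.tsum_comm]
    simp_rw [tsum_mul_left, (hb.convPow _).2.tsum_eq, mul_one]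
    exact ha.2.tsum_eq
  have h2 : Summable (RittProb.subordinate a b) := hs.prod_symm.prod
  exact h ▸ h2.hasSum

lemma pgf_subordinate {a b : ℕ → ℝ} (ha : IsProb a) (hb : IsProb b) {z : ℂ} (hz : ‖z‖ ≤ 1) :
    pgf (subordinate a b) z = pgf a (pgf b z) := by
  have hs : Summable (Function.uncurry fun k m : ℕ =>
      ((a k * convPow b k m : ℝ) : ℂ) * z ^ m) := by
    refine .of_norm_bounded (summable_subordinate_prod ha hb) fun p => ?_
    simp only [Function.uncurry]
    rw [norm_mul, norm_pow, Complex.norm_real, Real.norm_of_nonneg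
      (mul_nonneg (ha.1 _) ((hb.convPow _).1 _))]
    exact mul_le_of_le_one_right (mul_nonneg (ha.1 _) ((hb.convPow _).1 _))
      (pow_le_one₀ (norm_nonneg _) hz)
  simp only [pgf, subordinate, Complex.ofReal_tsum]
  simp_rw [← tsum_mul_right]
  rw [hs.tsum_comm]
  congr 1
  ext k
  change _ = (a k : ℂ) * pgf b z ^ k
  rw [← pgf_convPow hb k hz, pgf, ← tsum_mul_left]
  congr 1
  ext m
  push_cast
  ring

lemma subordinate_mem_classA {a b : ℕ → ℝ} (ha : a ∈ classA) (hb : IsProb b) (hb0 : b 0 = 0) :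
    subordinate a b ∈ classA := by
  refine ⟨ha.1.subordinate hb, lt_of_le_of_lt ?_ ha.2⟩
  gcongr with n hn
  rw [convPow_subordinate_sub hb0]
  exact l1Norm_subordinate_le _ hb

/-! ### Fourier inversion and pointwise decay -/

lemma integral_exp_int_mul (m : ℤ) :
    ∫ ξ in (-Real.pi)..Real.pi, Complex.exp (Complex.I * m * ξ) =
      if m = 0 then (2 * Real.pi : ℂ) else 0 := by
  split_ifs with h
  · subst h
    simp
    ring
  · have hc : Complex.I * (m : ℂ) ≠ 0 := mul_ne_zero Complex.I_ne_zero (by exact_mod_cast h)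
    rw [integral_exp_mul_complex hc, div_eq_zero_iff]
    left
    rw [sub_eq_zero, Complex.exp_eq_exp_iff_exists_int]
    refine ⟨m, ?_⟩
    push_cast
    ring

lemma integral_pgf_mul_exp {F : ℕ → ℝ} (hF : Summable fun k => |F k|) (k : ℕ) :
    ∫ ξ in (-Real.pi)..Real.pi,
      pgf F (Complex.exp (-(Complex.I * ξ))) * Complex.exp (Complex.I * k * ξ) =
        2 * Real.pi * F k := by
  have h := intervalIntegral.hasSum_integral_of_dominated_convergence
    (μ := MeasureTheory.volume) (a := -Real.pi) (b := Real.pi)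
    (F := fun (j : ℕ) (ξ : ℝ) => (F j : ℂ) * Complex.exp (-(Complex.I * ξ)) ^ j *
      Complex.exp (Complex.I * k * ξ))
    (f := fun ξ : ℝ => pgf F (Complex.exp (-(Complex.I * ξ))) * Complex.exp (Complex.I * k * ξ))
    (fun j _ => |F j|)
    (fun j => Continuous.aestronglyMeasurable (by fun_prop))
    (fun j => Eventually.of_forall fun ξ _ => by
      have h1 := norm_mul_pow_le F (norm_exp_neg_I_mul ξ).le j
      have h2 : ‖Complex.exp (Complex.I * k * ξ)‖ = 1 := by
        simpa [mul_assoc] using Complex.norm_exp_I_mul_ofReal (k * ξ)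
      rw [norm_mul, h2, mul_one]
      exact h1)
    (Eventually.of_forall fun ξ _ => hF)
    intervalIntegrable_const
    (Eventually.of_forall fun ξ _ => (hasSum_pgf hF (norm_exp_neg_I_mul ξ).le).mul_right _)
  have h2 : ∀ j : ℕ, (∫ ξ in (-Real.pi)..Real.pi,
      (F j : ℂ) * Complex.exp (-(Complex.I * ξ)) ^ j * Complex.exp (Complex.I * k * ξ)) =
        if j = k then (2 * Real.pi * F k : ℂ) else 0 := by
    intro j
    have h3 : ∀ ξ : ℝ, (F j : ℂ) * Complex.exp (-(Complex.I * ξ)) ^ j *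
        Complex.exp (Complex.I * k * ξ) =
          (F j : ℂ) * Complex.exp (Complex.I * ((k - j : ℤ) : ℂ) * ξ) := by
      intro ξ
      rw [← Complex.exp_nat_mul, mul_assoc, ← Complex.exp_add]
      congr 2
      push_cast
      ring
    simp_rw [h3]
    rw [intervalIntegral.integral_const_mul, integral_exp_int_mul]
    by_cases hjk : j = k
    · subst hjk
      simp
      ring
    · have : (k : ℤ) - j ≠ 0 := by omega
      simp [this, hjk]
  simp_rw [h2] at h
  exact h.unique (by simpa using hasSum_ite_eq k (2 * Real.pi * F k : ℂ))

lemma abs_le_integral_norm_pgf {F : ℕ → ℝ} (hF : Summable fun k => |F k|) (k : ℕ) :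
    2 * Real.pi * |F k| ≤
      ∫ ξ in (-Real.pi)..Real.pi, ‖pgf F (Complex.exp (-(Complex.I * ξ)))‖ := by
  have h := intervalIntegral.norm_integral_le_integral_norm (μ := MeasureTheory.volume)
    (f := fun ξ : ℝ => pgf F (Complex.exp (-(Complex.I * ξ))) * Complex.exp (Complex.I * k * ξ))
    (a := -Real.pi) (b := Real.pi) (by linarith [Real.pi_pos])
  rw [integral_pgf_mul_exp hF] at h
  have h2 : ∀ ξ : ℝ, ‖Complex.exp (Complex.I * k * ξ)‖ = 1 := fun ξ => by
    simpa [mul_assoc] using Complex.norm_exp_I_mul_ofReal (k * ξ)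
  simp only [norm_mul, h2, mul_one, Complex.norm_real, Complex.norm_ofNat, Real.norm_eq_abs,
    abs_of_pos Real.pi_pos] at h
  exact h

lemma pgf_sub {F G : ℕ → ℝ} (hF : Summable fun k => |F k|) (hG : Summable fun k => |G k|)
    {z : ℂ} (hz : ‖z‖ ≤ 1) : pgf (F - G) z = pgf F z - pgf G z := by
  rw [pgf, ← ((hasSum_pgf hF hz).sub (hasSum_pgf hG hz)).tsum_eq]
  congr 1
  ext k
  simp
  ring

lemma continuous_pgf_exp {F : ℕ → ℝ} (hF : Summable fun k => |F k|) :
    Continuous fun ξ : ℝ => pgf F (Complex.exp (-(Complex.I * ξ))) :=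
  (continuousOn_pgf hF).comp_continuous (by fun_prop)
    fun ξ => by simpa using (norm_exp_neg_I_mul ξ).le

lemma summable_abs_sub {F G : ℕ → ℝ} (hF : Summable fun k => |F k|)
    (hG : Summable fun k => |G k|) : Summable fun k => |(F - G) k| :=
  (hF.of_abs.sub hG.of_abs).abs

/-- The transform of the difference is `w (1 - w)^n` with `|w| ≤ |ξ|^β` and `|1 - w|^n ≤ exp (-b n
|ξ|^β)`. Integrating over the line gives a Gamma integral that scales as `n^{-(β+1)/β}`. -/
lemma exists_abs_convPow_sub_le {β : ℝ} (h0 : 0 < β) (h1 : β < 1) :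
    ∃ C : ℝ, 0 ≤ C ∧ ∀ n : ℕ, 1 ≤ n → ∀ k : ℕ,
      |(convPow (A β) n - convPow (A β) (n + 1)) k| ≤ C * (n : ℝ) ^ (-(β + 1) / β) := by
  obtain ⟨c, hc, hcle⟩ := exists_norm_one_sub_cpow_le h0 h1
  have hA := isProb_A h0 h1.le
  have hpi := Real.pi_pos
  set b := c * (2 / Real.pi) ^ β with hb
  have hb0 : 0 < b := by positivity
  set Γ := (1 / β) * Real.Gamma ((β + 1) / β) with hΓ
  have hΓ0 : 0 < Γ := by
    have : 0 < Real.Gamma ((β + 1) / β) := Real.Gamma_pos_of_pos (by positivity)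
    positivity
  refine ⟨(2 * Real.pi)⁻¹ * (2 * (b ^ (-(β + 1) / β) * Γ)), by positivity, fun n hn k => ?_⟩
  have hn0 : (0 : ℝ) < n := by exact_mod_cast hn
  have hs := summable_abs_sub (hA.convPow n).summable_abs (hA.convPow (n + 1)).summable_abs
  have hbn : 0 < b * n := by positivity
  have hval : ∫ ξ : ℝ, |ξ| ^ β * Real.exp (-(b * n) * |ξ| ^ β) =
      2 * (b ^ (-(β + 1) / β) * Γ) * (n : ℝ) ^ (-(β + 1) / β) := by
    rw [integral_comp_abs (f := fun x : ℝ => x ^ β * Real.exp (-(b * n) * x ^ β)),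
      integral_rpow_mul_exp_neg_mul_rpow h0 (by linarith) hbn, Real.mul_rpow hb0.le hn0.le, hΓ]
    ring
  have hi : MeasureTheory.Integrable
      (fun ξ : ℝ => |ξ| ^ β * Real.exp (-(b * n) * |ξ| ^ β)) := by
    -- A non-integrable function would have integral `0` by convention, but the computed value is
    -- positive.
    by_contra h
    rw [MeasureTheory.integral_undef h] at hval
    have : 0 < 2 * (b ^ (-(β + 1) / β) * Γ) * (n : ℝ) ^ (-(β + 1) / β) := by positivity
    linarith
  have key : ∫ ξ in (-Real.pi)..Real.pi,
      ‖pgf (convPow (A β) n - convPow (A β) (n + 1)) (Complex.exp (-(Complex.I * ξ)))‖ ≤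
        ∫ ξ : ℝ, |ξ| ^ β * Real.exp (-(b * n) * |ξ| ^ β) := by
    rw [intervalIntegral.integral_of_le (by linarith)]
    refine (MeasureTheory.setIntegral_mono_on ?_ hi.integrableOn measurableSet_Ioc ?_).trans
      (MeasureTheory.setIntegral_le_integral hi (Eventually.of_forall fun ξ => by positivity))
    · exact (continuous_pgf_exp hs).norm.integrableOn_Ioc
    · intro ξ hξ
      have hz := norm_exp_neg_I_mul ξ
      set z := Complex.exp (-(Complex.I * ξ)) with hzdef
      rw [pgf_sub (hA.convPow n).summable_abs (hA.convPow (n + 1)).summable_abs hz.le,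
        pgf_convPow hA _ hz.le, pgf_convPow hA _ hz.le, pgf_A h0 h1.le hz.le]
      have e : ∀ w : ℂ, (1 - w) ^ n - (1 - w) ^ (n + 1) = w * (1 - w) ^ n := fun w => by ring
      have hle := norm_one_sub_exp_le ξ
      have hge := le_norm_one_sub_exp (ξ := ξ) (abs_le.2 ⟨hξ.1.le, hξ.2⟩)
      rw [e, norm_mul, norm_pow]
      refine mul_le_mul ?_ ?_ (by positivity) (by positivity)
      · by_cases hz1 : z = 1
        · have : ((β : ℂ)) ≠ 0 := by exact_mod_cast h0.ne'
          rw [hz1, sub_self, Complex.zero_cpow this, norm_zero]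
          positivity
        · rw [norm_one_sub_cpow hz1]
          exact Real.rpow_le_rpow (norm_nonneg _) hle h0.le
      · refine (pow_le_pow_left₀ (norm_nonneg _) (hcle z hz.le) n).trans ?_
        rw [← Real.exp_nat_mul, Real.exp_le_exp]
        have h3 : (2 / Real.pi) ^ β * |ξ| ^ β ≤ ‖1 - z‖ ^ β := by
          rw [← Real.mul_rpow (by positivity) (abs_nonneg _)]
          exact Real.rpow_le_rpow (by positivity) hge h0.le
        have h4 := mul_le_mul_of_nonneg_left h3 (mul_pos hn0 hc).le
        rw [hb]
        nlinarith
  rw [hval] at key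
  have h5 := (abs_le_integral_norm_pgf hs k).trans key
  rw [← le_div_iff₀' (by positivity)] at h5
  refine h5.trans (le_of_eq ?_)
  ring

/-! ### `A β` is a Ritt probability -/

lemma coeff_X_mul_derivative (f : PowerSeries ℝ) (k : ℕ) :
    PowerSeries.coeff k (PowerSeries.X * PowerSeries.derivative ℝ f) =
      k * PowerSeries.coeff k f := by
  cases k with
  | zero => simp
  | succ k =>
    rw [PowerSeries.coeff_succ_X_mul, PowerSeries.coeff_derivative]
    push_cast
    ring

/-- Apply `X d/dX` to `f^{m+1} - f^{m+2}` and factor out `X f'`. This is formal, so `F` may have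
infinite mean. -/
lemma natCast_mul_convPow_sub (F : ℕ → ℝ) (m k : ℕ) :
    k * (convPow F (m + 1) - convPow F (m + 2)) k =
      conv (fun j => j * F j)
        (fun j => ((m : ℝ) + 1) * (convPow F m - convPow F (m + 1)) j - convPow F (m + 1) j) k := by
  set f := PowerSeries.mk F with hf
  have h1 : PowerSeries.mk (fun j : ℕ => (j : ℝ) * F j) =
      PowerSeries.X * PowerSeries.derivative ℝ f := by
    ext j
    rw [coeff_X_mul_derivative]
    simp [hf]
  have h2 : PowerSeries.mk (fun j => ((m : ℝ) + 1) * (convPow F m - convPow F (m + 1)) j -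
      convPow F (m + 1) j) = ((m : ℝ) + 1) • (f ^ m - f ^ (m + 1)) - f ^ (m + 1) := by
    ext j
    simp [convPow_eq_coeff, hf]
  have h3 : (convPow F (m + 1) - convPow F (m + 2)) k =
      PowerSeries.coeff k (f ^ (m + 1) - f ^ (m + 2)) := by
    simp [convPow_eq_coeff, hf]
  rw [conv_eq_coeff, h1, h2, h3, ← coeff_X_mul_derivative]
  congr 1
  rw [map_sub, Derivation.leibniz_pow, Derivation.leibniz_pow]
  simp only [smul_eq_mul, nsmul_eq_mul, Nat.add_sub_cancel, Algebra.smul_def,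
    show m + 2 - 1 = m + 1 from rfl]
  push_cast
  ring

/-- For `i > N` the terms are `A β i`, with sum `tailProd β N`. For `1 ≤ i ≤ N` they are `(β / N)
tailProd β (i - 1)`, summed by `sum_range_tailProd`. -/
lemma hasSum_mul_A_div_max {β : ℝ} (h0 : 0 < β) (h1 : β < 1) {N : ℕ} (hN : 1 ≤ N) :
    HasSum (fun i : ℕ => (i : ℝ) * A β i / (max i N : ℕ)) (tailProd β N / (1 - β)) := by
  have hN0 : (0 : ℝ) < N := by exact_mod_cast hN
  rw [← hasSum_nat_add_iff' (N + 1)]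
  have h2 := (hasSum_nat_add_iff' (N + 1)).2 (hasSum_A h0 h1.le)
  rw [sum_range_A] at h2
  have h3 : ∑ i ∈ Finset.range (N + 1), (i : ℝ) * A β i / (max i N : ℕ) =
      β * tailProd β N / (1 - β) := by
    rw [Finset.sum_range_succ']
    have h4 : ∀ i ∈ Finset.range N, ((i + 1 : ℕ) : ℝ) * A β (i + 1) / (max (i + 1) N : ℕ) =
        β / N * tailProd β i := by
      intro i hi
      rw [Finset.mem_range] at hi
      rw [max_eq_right (by omega), A_succ]
      push_cast
      field_simp
    rw [Finset.sum_congr rfl h4, ← Finset.mul_sum, A_zero, mul_zero, zero_div, add_zero]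
    have h5 := sum_range_tailProd β N
    have h6 : 1 - β ≠ 0 := by linarith
    rw [eq_div_iff h6, mul_assoc, mul_comm (∑ j ∈ _, _), h5]
    field_simp
  rw [h3]
  have h6 : 1 - β ≠ 0 := by linarith
  convert h2 using 1
  · ext i
    rw [max_eq_left (by omega), mul_div_cancel_left₀]
    positivity
  · field_simp
    ring

lemma tsum_abs_conv_le {t u : ℕ → ℝ} (ht : Summable fun k => |t k|)
    (hu : Summable fun k => |u k|) :
    ∑' k, conv (fun i => |t i|) (fun j => |u j|) k = (∑' k, |t k|) * ∑' k, |u k| :=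
  (tsum_mul_tsum_eq_tsum_sum_antidiagonal_of_summable_norm (f := fun i => |t i|)
    (g := fun j => |u j|) ht.norm hu.norm).symm

/-- In the convolution `i ≤ k`, and `N < k`, so `1 / k ≤ 1 / max i N`. The new weight does not
depend on `k`, so the bound can be summed over `k` as one convolution, even if `v` is not summable.
-/
lemma abs_le_conv_of_natCast_mul_eq_conv {v u h : ℕ → ℝ} (hv : ∀ i, 0 ≤ v i) {N k : ℕ}
    (hN : 0 < N) (hk : N < k) (hh : k * h k = conv v u k) :
    |h k| ≤ conv (fun i => |v i / (max i N : ℕ)|) (fun j => |u j|) k := by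
  have hk0 : (0 : ℝ) < k := by exact_mod_cast (Nat.zero_le N).trans_lt hk
  have h1 : h k = conv v u k / k := by rw [← hh]; field_simp
  rw [h1, abs_div, abs_of_pos hk0, div_le_iff₀ hk0, conv, conv, Finset.sum_mul]
  refine (Finset.abs_sum_le_sum_abs _ _).trans (Finset.sum_le_sum fun p hp => ?_)
  have hp1 : p.1 ≤ k := by
    have := Finset.HasAntidiagonal.mem_antidiagonal.1 hp
    omega
  rw [abs_mul, abs_of_nonneg (hv _), abs_of_nonneg (div_nonneg (hv _) (Nat.cast_nonneg _)),
    mul_right_comm]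
  refine mul_le_mul_of_nonneg_right ?_ (abs_nonneg _)
  have h2 : ((max p.1 N : ℕ) : ℝ) ≤ k := by exact_mod_cast max_le hp1 hk.le
  have h3 : (0 : ℝ) < (max p.1 N : ℕ) := by exact_mod_cast lt_max_of_lt_right hN
  rw [div_mul_eq_mul_div, le_div_iff₀ h3]
  exact mul_le_mul_of_nonneg_left h2 (hv _)

lemma A_mem_classA {β : ℝ} (h0 : 0 < β) (h1 : β < 1) : A β ∈ classA := by
  have hA := isProb_A h0 h1.le
  have hβ : 0 < 1 - β := by linarith
  obtain ⟨C, hC0, hC⟩ := exists_abs_convPow_sub_le h0 h1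
  set h : ℕ → ℕ → ℝ := fun n => convPow (A β) n - convPow (A β) (n + 1) with hh
  have hs : ∀ n, Summable fun k => |h n k| := fun n =>
    summable_abs_sub (hA.convPow n).summable_abs (hA.convPow (n + 1)).summable_abs
  set L : ℕ → ℝ := fun n => ∑' k, |h n k| with hL
  have hL2 : ∀ n, L n ≤ 2 := by
    intro n
    have h2 := (hA.convPow n).summable_abs
    have h3 := (hA.convPow (n + 1)).summable_abs
    calc L n ≤ ∑' k, (|convPow (A β) n k| + |convPow (A β) (n + 1) k|) :=
          (hs n).tsum_le_tsum (fun k => abs_sub _ _) (h2.add h3)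
      _ = 2 := by
          rw [h2.tsum_add h3, (hA.convPow n).tsum_abs, (hA.convPow (n + 1)).tsum_abs]
          norm_num
  -- Chosen so that the tail weight `tailProd β N / (1 - β)` is at most `1 / (4 n)`, which makes the
  -- recursion contract by `1/4`.
  set K : ℝ := (4 / (1 - β)) ^ (1 / β) with hK
  have hK0 : 0 < K := by positivity
  have hKβ : K ^ (-β) = (1 - β) / 4 := by
    rw [hK, ← Real.rpow_mul (by positivity), show 1 / β * -β = -1 by field_simp,
      Real.rpow_neg_one, inv_div]
  -- The first term is the head, where `N + 1 ≤ (K + 2) n^{1/β}`. The `3/4` is `(L m + 1) / 4` with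
  -- `L m ≤ 2`; here `L m` pays for replacing `m + 1` by `m`.
  set D : ℝ := (K + 2) * C + 3 / 4 with hD
  have step : ∀ m : ℕ, ((m + 1 : ℕ) : ℝ) * L (m + 1) ≤ D + m * L m / 4 := by
    intro m
    set n : ℝ := ((m + 1 : ℕ) : ℝ) with hn
    have hn1 : 1 ≤ n := by rw [hn]; exact_mod_cast Nat.le_add_left 1 m
    have hn0 : 0 < n := by linarith
    have hnβ : 1 ≤ n ^ (1 / β) := Real.one_le_rpow hn1 (by positivity)
    set N : ℕ := ⌈K * n ^ (1 / β)⌉₊ with hN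
    have hNge : K * n ^ (1 / β) ≤ N := Nat.le_ceil _
    have hN1 : 1 ≤ N := Nat.one_le_iff_ne_zero.2 (Nat.ceil_pos.2 (by positivity)).ne'
    have hNle : (N : ℝ) + 1 ≤ (K + 2) * n ^ (1 / β) := by
      have := (Nat.ceil_lt_add_one (show 0 ≤ K * n ^ (1 / β) by positivity)).le
      nlinarith
    have hP : tailProd β N ≤ (1 - β) / 4 / n := by
      refine (tailProd_le_rpow h0.le h1.le N).trans ?_
      calc ((N : ℝ) + 1) ^ (-β) ≤ (K * n ^ (1 / β)) ^ (-β) :=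
            Real.rpow_le_rpow_of_nonpos (by positivity) (by linarith) (by linarith)
        _ = (1 - β) / 4 / n := by
            rw [Real.mul_rpow hK0.le (by positivity), hKβ, ← Real.rpow_mul hn0.le,
              show 1 / β * -β = -1 by field_simp, Real.rpow_neg_one, ← div_eq_mul_inv]
    set u : ℕ → ℝ := fun j => ((m : ℝ) + 1) * h m j - convPow (A β) (m + 1) j with hu
    have hus : Summable fun j => |u j| :=
      (((hs m).of_abs.mul_left ((m : ℝ) + 1)).sub (hA.convPow (m + 1)).2.summable).abs
    have huL : ∑' j, |u j| ≤ n * L m + 1 := by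
      have h2 := (hs m).mul_left n
      have h3 := (hA.convPow (m + 1)).summable_abs
      calc ∑' j, |u j| ≤ ∑' j, (n * |h m j| + |convPow (A β) (m + 1) j|) := by
            refine hus.tsum_le_tsum (fun j => ?_) (h2.add h3)
            refine (abs_sub _ _).trans_eq ?_
            rw [abs_mul, hn, Nat.cast_succ, abs_of_nonneg (by positivity : (0 : ℝ) ≤ (m : ℝ) + 1)]
        _ = n * L m + 1 := by
            rw [h2.tsum_add h3, tsum_mul_left, (hA.convPow (m + 1)).tsum_abs]
    set t : ℕ → ℝ := fun i => (i : ℝ) * A β i / (max i N : ℕ) with ht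
    have hv : ∀ i : ℕ, 0 ≤ (i : ℝ) * A β i := fun i =>
      mul_nonneg (Nat.cast_nonneg i) (hA.1 i)
    have htsum : HasSum (fun i => |t i|) (tailProd β N / (1 - β)) := by
      have ht0 : ∀ i, |t i| = t i := fun i =>
        abs_of_nonneg (div_nonneg (hv i) (Nat.cast_nonneg _))
      simp_rw [ht0]
      exact hasSum_mul_A_div_max h0 h1 hN1
    have hconv := summable_abs_conv (F := fun i => |t i|) (G := fun j => |u j|)
      htsum.summable.abs hus.abs
    have htail : ∑' k, |h (m + 1) (k + (N + 1))| ≤ (1 / 4 / n) * (n * L m + 1) := by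
      calc ∑' k, |h (m + 1) (k + (N + 1))|
          ≤ ∑' k, conv (fun i => |t i|) (fun j => |u j|) (k + (N + 1)) := by
            refine ((summable_nat_add_iff (N + 1)).2 (hs (m + 1))).tsum_le_tsum (fun k => ?_)
              ((summable_nat_add_iff (N + 1)).2 hconv.of_abs)
            exact abs_le_conv_of_natCast_mul_eq_conv hv hN1 (by omega)
              (natCast_mul_convPow_sub (A β) m _)
        _ ≤ ∑' k, conv (fun i => |t i|) (fun j => |u j|) k := by
            rw [← hconv.of_abs.sum_add_tsum_nat_add (N + 1)]
            exact le_add_of_nonneg_left <| Finset.sum_nonneg fun k _ =>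
              Finset.sum_nonneg fun p _ => mul_nonneg (abs_nonneg _) (abs_nonneg _)
        _ = tailProd β N / (1 - β) * ∑' j, |u j| := by
            rw [tsum_abs_conv_le htsum.summable hus, htsum.tsum_eq]
        _ ≤ (1 / 4 / n) * (n * L m + 1) := by
            refine mul_le_mul ?_ huL (tsum_nonneg fun _ => abs_nonneg _) (by positivity)
            rw [div_le_iff₀ hβ]
            refine hP.trans (le_of_eq ?_)
            ring
    have hhead : ∑ k ∈ Finset.range (N + 1), |h (m + 1) k| ≤ (K + 2) * C / n := by
      calc ∑ k ∈ Finset.range (N + 1), |h (m + 1) k|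
          ≤ ∑ k ∈ Finset.range (N + 1), C * n ^ (-(β + 1) / β) :=
            Finset.sum_le_sum fun k _ => hC (m + 1) (by omega) k
        _ = ((N : ℝ) + 1) * (C * n ^ (-(β + 1) / β)) := by simp
        _ ≤ (K + 2) * n ^ (1 / β) * (C * n ^ (-(β + 1) / β)) := by gcongr
        _ = (K + 2) * C / n := by
            have : n ^ (1 / β) * n ^ (-(β + 1) / β) = n⁻¹ := by
              rw [← Real.rpow_add hn0, ← Real.rpow_neg_one]
              congr 1
              field_simp
              ring
            rw [div_eq_mul_inv _ n, ← this, mul_mul_mul_comm]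
    have hsplit : L (m + 1) = ∑ k ∈ Finset.range (N + 1), |h (m + 1) k| +
        ∑' k, |h (m + 1) (k + (N + 1))| := ((hs (m + 1)).sum_add_tsum_nat_add (N + 1)).symm
    have hle : L (m + 1) ≤ (K + 2) * C / n + (1 / 4 / n) * (n * L m + 1) := by linarith
    have h6 : n * L (m + 1) ≤ (K + 2) * C + (n * L m + 1) / 4 := by
      have := mul_le_mul_of_nonneg_left hle hn0.le
      refine this.trans (le_of_eq ?_)
      field_simp
    have h7 : n * L m = m * L m + L m := by rw [hn]; push_cast; ring
    have h8 := hL2 m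
    rw [hD]
    linarith
  have hD0 : 0 ≤ D := by positivity
  have hbound : ∀ n : ℕ, (n : ℝ) * L n ≤ 2 * D := by
    intro n
    induction n with
    | zero => simpa using hD0
    | succ m ih => linarith [step m]
  refine ⟨hA, lt_of_le_of_lt (iSup₂_le fun n _ => ?_) (ENNReal.ofReal_lt_top (r := 2 * D))⟩
  rw [l1Norm_eq_ofReal (hs n), ← ENNReal.ofReal_natCast, ← ENNReal.ofReal_mul (Nat.cast_nonneg n)]
  exact ENNReal.ofReal_le_ofReal (hbound n)

/-! ### The average `B` and the lower bound near zero -/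

lemma hasSum_B_mul_pow {ε : ℝ} (hε : ε ∈ Set.Ioc (0 : ℝ) 1) {z : ℂ} (hz : ‖z‖ ≤ 1) :
    HasSum (fun k : ℕ => (B ε k : ℂ) * z ^ k)
      ((ε : ℂ)⁻¹ * ∫ α in (0 : ℝ)..ε, (1 - (1 - z) ^ (α : ℂ))) := by
  have hI : Set.uIoc 0 ε = Set.Ioc 0 ε := Set.uIoc_of_le hε.1.le
  have hA : ∀ {α : ℝ}, α ∈ Set.uIoc 0 ε → IsProb (A α) := fun {α} hα => by
    rw [hI] at hα
    exact isProb_A hα.1 (hα.2.trans hε.2)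
  have h := intervalIntegral.hasSum_integral_of_dominated_convergence
    (μ := MeasureTheory.volume) (a := 0) (b := ε)
    (F := fun (k : ℕ) (α : ℝ) => (A α k : ℂ) * z ^ k)
    (f := fun α : ℝ => 1 - (1 - z) ^ (α : ℂ))
    (fun k α => |A α k|)
    (fun k => ((Complex.continuous_ofReal.comp (continuous_A k)).mul
      continuous_const).aestronglyMeasurable)
    (fun k => Eventually.of_forall fun α _ => norm_mul_pow_le (A α) hz k)
    (Eventually.of_forall fun α hα => (hA hα).summable_abs)
    -- The dominating series sums to `1` for every `α` in the interval.
    ((intervalIntegrable_const (c := (1 : ℝ))).congr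
      fun α hα => (hA hα).tsum_abs.symm)
    (Eventually.of_forall fun α hα => by
      have h1 := hasSum_pgf (hA hα).summable_abs hz
      rw [hI] at hα
      rwa [pgf_A hα.1 (hα.2.trans hε.2) hz] at h1)
  have h1 : (fun k : ℕ => (B ε k : ℂ) * z ^ k) =
      fun k : ℕ => (ε : ℂ)⁻¹ * ∫ α in (0 : ℝ)..ε, (A α k : ℂ) * z ^ k := by
    ext k
    rw [intervalIntegral.integral_mul_const, intervalIntegral.integral_ofReal, B]
    push_cast
    ring
  rw [h1]
  exact h.mul_left (ε : ℂ)⁻¹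

lemma isProb_B {ε : ℝ} (hε : ε ∈ Set.Ioc (0 : ℝ) 1) : IsProb (B ε) := by
  constructor
  · intro k
    refine mul_nonneg (inv_nonneg.2 hε.1.le)
      (intervalIntegral.integral_nonneg hε.1.le fun α hα => A_nonneg hα.1 (hα.2.trans hε.2) k)
  · have h := hasSum_B_mul_pow hε (z := 1) (by simp)
    have h2 : ∫ α in (0 : ℝ)..ε, (1 - (1 - (1 : ℂ)) ^ (α : ℂ)) = ε := by
      have : ∫ α in (0 : ℝ)..ε, (1 - (1 - (1 : ℂ)) ^ (α : ℂ)) = ∫ _ in (0 : ℝ)..ε, (1 : ℂ) := by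
        refine intervalIntegral.integral_congr_ae (Eventually.of_forall fun α hα => ?_)
        -- The half-open interval excludes `α = 0`, where `0 ^ 0 = 1` would spoil the integrand.
        rw [Set.uIoc_of_le hε.1.le] at hα
        have : (α : ℂ) ≠ 0 := by exact_mod_cast hα.1.ne'
        rw [sub_self, Complex.zero_cpow this, sub_zero]
      rw [this]
      simp
    have h3 : (ε : ℂ) ≠ 0 := by exact_mod_cast hε.1.ne'
    rw [h2, inv_mul_cancel₀ h3] at h
    rw [← Complex.hasSum_ofReal]
    simpa using h

lemma B_zero (ε : ℝ) : B ε 0 = 0 := by simp [B, A_zero]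

lemma one_sub_pgf_B {ε : ℝ} (hε : ε ∈ Set.Ioc (0 : ℝ) 1) {z : ℂ} (hz : ‖z‖ ≤ 1) (hz1 : z ≠ 1) :
    1 - pgf (B ε) z = (ε : ℂ)⁻¹ * ∫ α in (0 : ℝ)..ε, (1 - z) ^ (α : ℂ) := by
  have hc : Continuous fun α : ℝ => (1 - z) ^ (α : ℂ) :=
    Complex.continuous_ofReal.const_cpow (Or.inl (sub_ne_zero.2 hz1.symm))
  have h3 : (ε : ℂ) ≠ 0 := by exact_mod_cast hε.1.ne'
  rw [pgf, (hasSum_B_mul_pow hε hz).tsum_eq, intervalIntegral.integral_sub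
    intervalIntegrable_const (hc.intervalIntegrable _ _)]
  simp
  field_simp
  ring

/-- Take real parts: the integrand is nonnegative throughout, so only `[0, δ]` is kept. There the
argument of the power is at most `π/4`, so its cosine exceeds `1/2`, and `|1 - z| ≤ 1` gives `|1 -
z|^α ≥ |1 - z|^δ`. -/
lemma le_norm_one_sub_pgf_B {ε δ : ℝ} (hε : ε ∈ Set.Ioc (0 : ℝ) 1) (hδ : 0 < δ) (hδε : δ ≤ ε)
    (hδ2 : δ ≤ 1 / 2) {z : ℂ} (hz : ‖z‖ ≤ 1) (hz1 : z ≠ 1) (hz2 : ‖1 - z‖ ≤ 1) :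
    ε⁻¹ * (δ / 2) * ‖1 - z‖ ^ δ ≤ ‖1 - pgf (B ε) z‖ := by
  have hpos : 0 < ‖1 - z‖ := norm_pos_iff.2 (sub_ne_zero.2 hz1.symm)
  have hc : Continuous fun α : ℝ => (1 - z) ^ (α : ℂ) :=
    Complex.continuous_ofReal.const_cpow (Or.inl (sub_ne_zero.2 hz1.symm))
  have hcr : Continuous fun α : ℝ => ((1 - z) ^ (α : ℂ)).re := Complex.continuous_re.comp hc
  have harg := abs_arg_one_sub_le hz hz1
  have hpi := Real.pi_pos
  have hcos : ∀ α : ℝ, 0 ≤ α → α ≤ 1 → 0 ≤ ((1 - z) ^ (α : ℂ)).re := by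
    intro α h0 h1
    rw [Complex.cpow_ofReal_re]
    refine mul_nonneg (by positivity) ((Real.cos_nonneg_of_mem_Icc ?_).trans
      (cos_mul_pi_div_two_le h0 h1 harg))
    constructor <;> nlinarith
  have hcos2 : ∀ α ∈ Set.Icc 0 δ, ‖1 - z‖ ^ δ / 2 ≤ ((1 - z) ^ (α : ℂ)).re := by
    intro α hα
    rw [Complex.cpow_ofReal_re, div_eq_mul_inv]
    refine mul_le_mul (Real.rpow_le_rpow_of_exponent_ge hpos hz2 hα.2) ?_ (by norm_num)
      (by positivity)
    refine le_trans ?_ (cos_mul_pi_div_two_le hα.1 (by linarith [hα.2]) harg)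
    rw [← one_div, ← Real.cos_pi_div_three]
    have := hα.1
    have := hα.2
    exact Real.cos_le_cos_of_nonneg_of_le_pi (by positivity) (by linarith) (by nlinarith)
  have h1 : (1 - pgf (B ε) z).re = ε⁻¹ * ∫ α in (0 : ℝ)..ε, ((1 - z) ^ (α : ℂ)).re := by
    rw [one_sub_pgf_B hε hz hz1, ← Complex.ofReal_inv, Complex.re_ofReal_mul]
    congr 1
    exact (Complex.reCLM.intervalIntegral_comp_comm (hc.intervalIntegrable _ _)).symm
  have h2 : δ / 2 * ‖1 - z‖ ^ δ ≤ ∫ α in (0 : ℝ)..ε, ((1 - z) ^ (α : ℂ)).re := by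
    rw [← intervalIntegral.integral_add_adjacent_intervals (hcr.intervalIntegrable 0 δ)
      (hcr.intervalIntegrable δ ε)]
    have h3 := intervalIntegral.integral_mono_on hδ.le
      (intervalIntegrable_const (μ := MeasureTheory.volume)) (hcr.intervalIntegrable 0 δ) hcos2
    have h4 : 0 ≤ ∫ α in δ..ε, ((1 - z) ^ (α : ℂ)).re :=
      intervalIntegral.integral_nonneg hδε fun α hα =>
        hcos α (hδ.le.trans hα.1) (hα.2.trans hε.2)
    rw [intervalIntegral.integral_const, smul_eq_mul, sub_zero] at h3
    linarith
  refine le_trans ?_ (Complex.re_le_norm _)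
  rw [h1, mul_assoc]
  exact mul_le_mul_of_nonneg_left h2 (inv_nonneg.2 hε.1.le)

lemma exists_le_norm_one_sub_fourier_Bsub {ε β : ℝ} (hε : ε ∈ Set.Ioc (0 : ℝ) 1)
    (hβ : β ∈ Set.Ioo (0 : ℝ) 1) {γ : ℝ} (hγ : 0 < γ) :
    ∃ c : ℝ, 0 < c ∧ ∀ ξ : ℝ, ξ ≠ 0 → |ξ| ≤ 1 →
      c * |ξ| ^ γ ≤ ‖1 - fourier (Bsub ε β) ξ‖ := by
  -- The first two bounds are those of `le_norm_one_sub_pgf_B`; `δ ≤ γ` ensures `δ β ≤ γ`.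
  set δ := min ε (min (1 / 2) γ) with hδ
  have hδ0 : 0 < δ := lt_min hε.1 (lt_min (by norm_num) hγ)
  have hδγ : δ ≤ γ := (min_le_right _ _).trans (min_le_right _ _)
  have hpi := Real.pi_gt_three
  have hε0 := hε.1
  have hβ0 := hβ.1
  refine ⟨(ε⁻¹ * (δ / 2) * (2 / Real.pi) ^ δ) ^ β, by positivity, fun ξ hξ0 hξ1 => ?_⟩
  have hz := (norm_exp_neg_I_mul ξ).le
  have hge := le_norm_one_sub_exp (ξ := ξ) (by linarith)
  have hle := (norm_one_sub_exp_le ξ).trans hξ1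
  rw [fourier_eq_pgf]
  set z := Complex.exp (-(Complex.I * ξ))
  have hξ : 0 < |ξ| := abs_pos.2 hξ0
  have hz1 : z ≠ 1 := by
    intro h
    rw [h, sub_self, norm_zero] at hge
    have : 0 < 2 / Real.pi * |ξ| := by positivity
    linarith
  have hB := isProb_B hε
  have h1 : ε⁻¹ * (δ / 2) * ((2 / Real.pi) ^ δ * |ξ| ^ δ) ≤ ‖1 - pgf (B ε) z‖ := by
    refine le_trans ?_ (le_norm_one_sub_pgf_B hε hδ0 (min_le_left _ _)
      ((min_le_right _ _).trans (min_le_left _ _)) hz hz1 hle)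
    rw [← Real.mul_rpow (by positivity) hξ.le]
    gcongr
  have h2 : pgf (B ε) z ≠ 1 := by
    intro h
    rw [h, sub_self, norm_zero] at h1
    have : 0 < ε⁻¹ * (δ / 2) * ((2 / Real.pi) ^ δ * |ξ| ^ δ) := by positivity
    linarith
  rw [Bsub_eq_subordinate, pgf_subordinate (isProb_A hβ.1 hβ.2.le) hB hz,
    pgf_A hβ.1 hβ.2.le (hB.norm_pgf_le_one hz), sub_sub_cancel, norm_one_sub_cpow h2]
  calc (ε⁻¹ * (δ / 2) * (2 / Real.pi) ^ δ) ^ β * |ξ| ^ γ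
      ≤ (ε⁻¹ * (δ / 2) * (2 / Real.pi) ^ δ) ^ β * |ξ| ^ (δ * β) := by
        refine mul_le_mul_of_nonneg_left ?_ (by positivity)
        exact Real.rpow_le_rpow_of_exponent_ge hξ hξ1 (by nlinarith [hβ.2])
    _ = (ε⁻¹ * (δ / 2) * ((2 / Real.pi) ^ δ * |ξ| ^ δ)) ^ β := by
        rw [← mul_assoc, Real.rpow_mul hξ.le,
          ← Real.mul_rpow (by positivity) (by positivity)]
    _ ≤ ‖1 - pgf (B ε) z‖ ^ β := Real.rpow_le_rpow (by positivity) h1 hβ.1.le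

lemma tendsto_abs_rpow {γ : ℝ} (hγ : 0 < γ) :
    Tendsto (fun ξ : ℝ => |ξ| ^ γ) (𝓝[≠] 0) (𝓝 0) := by
  have h : Continuous fun ξ : ℝ => |ξ| ^ γ := continuous_abs.rpow_const fun _ => Or.inr hγ.le
  have h2 := h.tendsto 0
  simp only [abs_zero, Real.zero_rpow hγ.ne'] at h2
  exact h2.mono_left nhdsWithin_le_nhds

lemma tendsto_abs_rpow_div {ε β : ℝ} (hε : ε ∈ Set.Ioc (0 : ℝ) 1) (hβ : β ∈ Set.Ioo (0 : ℝ) 1)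
    {α : ℝ} (hα : 0 < α) :
    Tendsto (fun ξ : ℝ => |ξ| ^ α / ‖1 - fourier (Bsub ε β) ξ‖) (𝓝[≠] 0) (𝓝 0) := by
  obtain ⟨c, hc, h⟩ := exists_le_norm_one_sub_fourier_Bsub hε hβ (half_pos hα)
  have h2 := (tendsto_abs_rpow (half_pos hα)).div_const c
  rw [zero_div] at h2
  refine squeeze_zero' (Eventually.of_forall fun ξ => by positivity) ?_ h2
  filter_upwards [self_mem_nhdsWithin,
    nhdsWithin_le_nhds (Metric.closedBall_mem_nhds (0 : ℝ) one_pos)] with ξ hξ hξ1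
  have hξ1 : |ξ| ≤ 1 := by simpa using hξ1
  have hξ0 : 0 < |ξ| := abs_pos.2 hξ
  have h3 := h ξ hξ hξ1
  have h4 : 0 < c * |ξ| ^ (α / 2) := by positivity
  rw [div_le_div_iff₀ (h4.trans_le h3) hc]
  have h5 : |ξ| ^ α = |ξ| ^ (α / 2) * |ξ| ^ (α / 2) := by
    rw [← Real.rpow_add hξ0, add_halves]
  rw [h5, mul_assoc]
  refine mul_le_mul_of_nonneg_left ?_ (by positivity)
  linarith

/-! ### Hölder continuity at zero as the obstruction -/

/-- `F̂` is Hölder continuous of order `α` at `0`, from the right. -/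
def HolderAtZero (α : ℝ) (F : ℕ → ℝ) : Prop :=
  ∃ C : ℝ, ∀ ξ ∈ Set.Ioc (0 : ℝ) 1, ‖1 - fourier F ξ‖ ≤ C * ξ ^ α

/-- The lower bound with exponent `α / 2` would force `c ≤ C ξ^{α/2}`, which fails as `ξ → 0`. -/
lemma not_holderAtZero_Bsub {ε β : ℝ} (hε : ε ∈ Set.Ioc (0 : ℝ) 1) (hβ : β ∈ Set.Ioo (0 : ℝ) 1)
    {α : ℝ} (hα : 0 < α) : ¬ HolderAtZero α (Bsub ε β) := by
  rintro ⟨C, hC⟩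
  obtain ⟨c, hc, h⟩ := exists_le_norm_one_sub_fourier_Bsub hε hβ (half_pos hα)
  have h1 := ((tendsto_abs_rpow (half_pos hα)).mono_left
    (nhdsWithin_mono (0 : ℝ) fun x (hx : x ∈ Set.Ioi 0) => ne_of_gt hx)).const_mul C
  rw [mul_zero] at h1
  obtain ⟨ξ, hξ, hξ'⟩ := ((h1.eventually_lt_const hc).and
    (Ioc_mem_nhdsGT (zero_lt_one' ℝ))).exists
  have h2 := (h ξ hξ'.1.ne' (by rw [abs_of_pos hξ'.1]; exact hξ'.2)).trans (hC ξ hξ')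
  have h0 := hξ'.1
  rw [abs_of_pos h0] at h2 hξ
  have h5 : ξ ^ α = ξ ^ (α / 2) * ξ ^ (α / 2) := by
    rw [← Real.rpow_add h0, add_halves]
  rw [h5, ← mul_assoc] at h2
  exact absurd (le_of_mul_le_mul_right h2 (by positivity)) hξ.not_ge

lemma IsProb.fourier_zero {F : ℕ → ℝ} (hF : IsProb F) : fourier F 0 = 1 := by
  rw [fourier_eq_pgf]
  simpa using pgf_one hF

lemma IsProb.continuous_fourier {F : ℕ → ℝ} (hF : IsProb F) : Continuous (fourier F) := by
  have : fourier F = fun ξ : ℝ => pgf F (Complex.exp (-(Complex.I * ξ))) :=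
    funext (fourier_eq_pgf F)
  rw [this]
  exact continuous_pgf_exp hF.summable_abs

lemma DerivBound.holderAtZero {F : ℕ → ℝ} (hF : IsProb F) {α : ℝ} (hα : 0 < α)
    (h : DerivBound α F) : HolderAtZero α F := by
  obtain ⟨c, hc, h⟩ := h
  refine ⟨c / α, fun ξ hξ => ?_⟩
  have hpi := Real.pi_gt_three
  -- The derivative is controlled only away from `0`, so the mean value inequality runs on `[η, ξ]`
  -- with a constant independent of `η`; continuity then lets `η → 0`.
  have key : ∀ η ∈ Set.Ioo 0 ξ, ‖fourier F ξ - fourier F η‖ ≤ c / α * ξ ^ α := by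
    intro η hη
    have hderiv : ∀ x ∈ Set.Ico η ξ, HasDerivAt (fourier F)
        (derivWithin (fourier F) (Set.Icc (-Real.pi) Real.pi) x) x := by
      intro x hx
      have hx1 : -Real.pi < x := by linarith [hx.1, hη.1]
      have hx2 : x < Real.pi := by linarith [hx.2, hξ.2]
      exact (h x ⟨hx1.le, hx2.le⟩ (hη.1.trans_le hx.1).ne').1.hasDerivWithinAt.hasDerivAt
        (Icc_mem_nhds hx1 hx2)
    refine image_norm_le_of_norm_deriv_right_le_deriv_boundary'
      (f := fun x => fourier F x - fourier F η) (a := η) (b := ξ)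
      (B := fun x => c / α * x ^ α) (B' := fun x => c * x ^ (α - 1))
      (hF.continuous_fourier.sub continuous_const).continuousOn
      (fun x hx => ((hderiv x hx).sub_const _).hasDerivWithinAt) ?_ ?_ ?_ ?_ ⟨hη.2.le, le_rfl⟩
    · have := hη.1
      simp only [sub_self, norm_zero]
      positivity
    · exact (continuous_const.mul
        (continuous_id.rpow_const fun _ => Or.inr hα.le)).continuousOn
    · intro x hx
      have h1 := ((Real.hasDerivAt_rpow_const (p := α)
        (Or.inl (hη.1.trans_le hx.1).ne')).const_mul (c / α)).hasDerivWithinAt (s := Set.Ici x)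
      rwa [← mul_assoc, div_mul_cancel₀ c hα.ne'] at h1
    · intro x hx
      have hx0 := hη.1.trans_le hx.1
      have h1 := (h x ⟨by linarith [hx.1, hη.1], by linarith [hx.2, hξ.2]⟩ hx0.ne').2
      rwa [abs_of_pos hx0] at h1
  have h1 : Tendsto (fun η => ‖fourier F ξ - fourier F η‖) (𝓝[>] 0)
      (𝓝 ‖fourier F ξ - fourier F 0‖) :=
    ((continuous_const.sub hF.continuous_fourier).norm.tendsto 0).mono_left nhdsWithin_le_nhds
  rw [norm_sub_rev, ← hF.fourier_zero]
  refine le_of_tendsto h1 ?_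
  filter_upwards [Ioo_mem_nhdsGT hξ.1] with η hη using key η hη

/-- Both masses are `1`, so each `1 - Ĥ` is `∑ H(k) (1 - e^{-ikξ})`, and `|1 - e^{-ikξ}| ≤ k |ξ|`.
-/
lemma norm_fourier_sub_sub_le {F G : ℕ → ℝ} (hF : IsProb F) (hG : IsProb G) {a : ℝ}
    (h : Summable fun k : ℕ => (k : ℝ) * |G k - a * F k|) (ξ : ℝ) :
    ‖(1 - fourier G ξ) - a * (1 - fourier F ξ)‖ ≤
      (∑' k : ℕ, (k : ℝ) * |G k - a * F k|) * |ξ| := by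
  have hz := norm_exp_neg_I_mul ξ
  have h1 : ∀ {H : ℕ → ℝ}, IsProb H → HasSum (fun k : ℕ =>
      (H k : ℂ) * (1 - Complex.exp (-(Complex.I * ξ)) ^ k)) (1 - fourier H ξ) := by
    intro H hH
    have h2 := (Complex.hasSum_ofReal.2 hH.2).sub (hasSum_pgf hH.summable_abs hz.le)
    rw [← fourier_eq_pgf, Complex.ofReal_one] at h2
    simpa [mul_sub] using h2
  have h3 := (h1 hG).sub ((h1 hF).mul_left (a : ℂ))
  rw [← h3.tsum_eq]
  refine tsum_of_norm_bounded (h.hasSum.mul_right |ξ|) fun k => ?_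
  have h4 : (G k : ℂ) * (1 - Complex.exp (-(Complex.I * ξ)) ^ k) -
      a * ((F k : ℂ) * (1 - Complex.exp (-(Complex.I * ξ)) ^ k)) =
        ((G k - a * F k : ℝ) : ℂ) * (1 - Complex.exp (-(Complex.I * (k * ξ : ℝ)))) := by
    rw [← Complex.exp_nat_mul]
    push_cast
    ring_nf
  have h5 := norm_one_sub_exp_le (k * ξ)
  rw [abs_mul, Nat.abs_cast] at h5
  rw [h4, norm_mul, Complex.norm_real, Real.norm_eq_abs]
  calc |G k - a * F k| * ‖1 - Complex.exp (-(Complex.I * (k * ξ : ℝ)))‖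
      ≤ |G k - a * F k| * (k * |ξ|) := mul_le_mul_of_nonneg_left h5 (abs_nonneg _)
    _ = k * |G k - a * F k| * |ξ| := by ring

lemma ComparisonCriterion.holderAtZero {G : ℕ → ℝ} {α : ℝ} (hα : α ∈ Set.Ioo (0 : ℝ) 1)
    (h : ComparisonCriterion α G) : HolderAtZero α G := by
  obtain ⟨hG, -, F, ⟨hF, -, -, hFd⟩, a, ha, hs⟩ := h
  obtain ⟨C, hC⟩ := hFd.holderAtZero hF hα.1
  set S := ∑' k : ℕ, (k : ℝ) * |G k - a * F k|
  have hS : 0 ≤ S := tsum_nonneg fun k => by positivity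
  refine ⟨S + a * C, fun ξ hξ => ?_⟩
  have h1 := norm_fourier_sub_sub_le hF hG hs ξ
  have h2 := hC ξ hξ
  have h3 : ξ ≤ ξ ^ α := by
    simpa using Real.rpow_le_rpow_of_exponent_ge hξ.1 hξ.2 hα.2.le
  rw [abs_of_pos hξ.1] at h1
  calc ‖1 - fourier G ξ‖
      = ‖((1 - fourier G ξ) - a * (1 - fourier F ξ)) + a * (1 - fourier F ξ)‖ := by
        rw [sub_add_cancel]
    _ ≤ S * ξ + a * (C * ξ ^ α) := by
        refine (norm_add_le _ _).trans (add_le_add h1 ?_)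
        rw [norm_mul, Complex.norm_real, Real.norm_of_nonneg ha.le]
        exact mul_le_mul_of_nonneg_left h2 ha.le
    _ ≤ S * ξ ^ α + a * (C * ξ ^ α) := by gcongr
    _ = (S + a * C) * ξ ^ α := by ring

end RittProb

end

theorem theorem6p1 (ε : ℝ) (hε : ε ∈ Set.Ioc (0 : ℝ) 1) :
    RittProb.IsProb (RittProb.B ε) ∧
    ∀ β ∈ Set.Ioo (0 : ℝ) 1,
      RittProb.Bsub ε β ∈ RittProb.classA ∧
      (∀ᶠ ξ in 𝓝[≠] (0 : ℝ), RittProb.fourier (RittProb.Bsub ε β) ξ ≠ 1) ∧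
      ∀ α ∈ Set.Ioo (0 : ℝ) 1,
        Tendsto (fun ξ : ℝ => |ξ| ^ α / ‖1 - RittProb.fourier (RittProb.Bsub ε β) ξ‖)
          (𝓝[≠] 0) (𝓝 0) ∧
        ¬ RittProb.DerivBound α (RittProb.Bsub ε β) ∧
        ¬ RittProb.FourierCriterion α (RittProb.Bsub ε β) ∧
        ¬ RittProb.ComparisonCriterion α (RittProb.Bsub ε β) := by
  have hB := RittProb.isProb_B hε
  refine ⟨hB, fun β hβ => ?_⟩
  have hBsub : RittProb.IsProb (RittProb.Bsub ε β) :=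
    (RittProb.isProb_A hβ.1 hβ.2.le).subordinate hB
  refine ⟨RittProb.subordinate_mem_classA (RittProb.A_mem_classA hβ.1 hβ.2) hB
    (RittProb.B_zero ε), ?_, fun α hα => ?_⟩
  · obtain ⟨c, hc, h⟩ := RittProb.exists_le_norm_one_sub_fourier_Bsub hε hβ one_pos
    filter_upwards [self_mem_nhdsWithin,
      nhdsWithin_le_nhds (Metric.closedBall_mem_nhds (0 : ℝ) one_pos)] with ξ hξ hξ1 heq
    have h1 := h ξ hξ (by simpa using hξ1)
    rw [heq, sub_self, norm_zero] at h1
    have : 0 < |ξ| := abs_pos.2 hξ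
    have : 0 < c * |ξ| ^ (1 : ℝ) := by positivity
    linarith
  · have hn := RittProb.not_holderAtZero_Bsub hε hβ hα.1
    exact ⟨RittProb.tendsto_abs_rpow_div hε hβ hα.1, fun h => hn (h.holderAtZero hBsub hα.1),
      fun h => hn (h.2.2.2.holderAtZero hBsub hα.1), fun h => hn (h.holderAtZero hα)⟩
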